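/- Let $N\ge 1$ be an integer, $p>1$ and $q=\frac{2p}{p+1}$, and put $$M_\dagger=\left(\frac{p-1}{p+1}\right)^{\frac{p-1}{p+1}}\left(\frac{N(p+1)^2}{4p}\right)^{\frac{p}{p+1}}.$$ For $M\in\mathbb R$ and an open set $\Omega\subset\mathbb R^N$, a solution in $\Omega$ means a nonnegative function $u\in C^2(\Omega)$ satisfying $$-\Delta u=|u|^{p-1}u+M|\nabla u|^q\quad\text{in }\Omega .$$ (i) For every $\nu>0$ there is a constant $c=c_{N,p,\nu}>0$, depending only on $N$, $p$ and $\nu$, such that for every $M>M_\dagger$ with $(1-\nu)M>M_\dagger$, every domain (nonempty connected open set) $\Omega\subset\mathbb R^N$ and every solution $u$ in $\Omega$, $$|\nabla u(x)|\le c\,\bigl((1-\nu)M-M_\dagger\bigr)^{-\frac{p+1}{p-1}}\,\operatorname{dist}(x,\partial\Omega)^{-\frac{p+1}{p-1}}\qquad\text{for all }x\in\Omega ,$$ where, if $\Omega=\mathbb R^N$, $\operatorname{dist}(x,\partial\Omega)=\infty$ and the right-hand side is $0$. (ii) Consequently, for every $M>M_\dagger$ there is no nontrivial solution in $\mathbb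 R^N$, that is, the only solution in $\mathbb R^N$ is $u\equiv 0$. -/

import Mathlib

noncomputable section

/-- Nonnegative classical (`C²`) solutions in the open set `Ω` of
`-Δu = |u|^(p-1) u + M |∇u|^q`. Only the values of `u` on `Ω` matter. -/
structure IsNonnegSolution {N : ℕ} (p q M : ℝ) (Ω : Set (EuclideanSpace ℝ (Fin N)))
    (u : EuclideanSpace ℝ (Fin N) → ℝ) : Prop where
  contDiffOn : ContDiffOn ℝ 2 u Ω
  nonneg : ∀ x ∈ Ω, 0 ≤ u x
  equation : ∀ x ∈ Ω,
    -(Laplacian.laplacian u x) = |u x| ^ (p - 1) * u x + M * ‖gradient u x‖ ^ q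

/-- The threshold
`((p-1)/(p+1))^((p-1)/(p+1)) * (N (p+1)^2 / (4p))^(p/(p+1))`. -/
def MDagger (N : ℕ) (p : ℝ) : ℝ :=
  ((p - 1) / (p + 1)) ^ ((p - 1) / (p + 1)) *
    ((N : ℝ) * (p + 1) ^ 2 / (4 * p)) ^ (p / (p + 1))

end

open Filter Topology Metric

noncomputable section

variable {N : ℕ}

/-! Bernstein's method applied to `z = |∇u|²`. Bochner's formula and Cauchy–Schwarz give `½Δz ≥
(Δu)²/N + ∇u·∇Δu`. Once the equation is inserted, the harmful term is `p u^(p-1) z`. `MDagger` is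
the constant for which Young's inequality gives `N p u^(p-1) z ≤ (u^p + MDagger z^(q/2))²`
(`mul_rpow_mul_sq_le`), so for `M > MDagger` a multiple of `z^q` survives in `(Δu)²`. At a maximum
of `z (R² - |x - x₀|²)^k` this bounds `z`, hence `|∇u(x₀)|` (`IsNonnegSolution.norm_gradient_le`).

As `u` is only `C²`, Bochner's formula is unavailable. `exists_bernstein_point` maximizes the
weighted squared discrete gradient instead and lets the step tend to zero. The only third-order
quantity, `∇Δu`, exists at the limit point because the equation writes `Δu` through `u` and `z`, and
`z ≠ 0` there.

On the whole space the distance is infinite, so `∇u = 0`, and a constant solution vanishes. -/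

/-! ### Difference quotients and partial derivatives. -/

/-- The `i`-th vector of the standard basis. -/
abbrev stdVec (i : Fin N) : EuclideanSpace ℝ (Fin N) := EuclideanSpace.single i (1 : ℝ)

/-- The `i`-th partial derivative. -/
def partialDeriv (i : Fin N) (u : EuclideanSpace ℝ (Fin N) → ℝ)
    (x : EuclideanSpace ℝ (Fin N)) : ℝ :=
  fderiv ℝ u x (stdVec i)

/-- The forward difference quotient of step `h` in the `i`-th direction. -/
def diffQuot (h : ℝ) (i : Fin N) (u : EuclideanSpace ℝ (Fin N) → ℝ)
    (x : EuclideanSpace ℝ (Fin N)) : ℝ :=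
  h⁻¹ * (u (x + h • stdVec i) - u x)

/-- Necessary second-order condition at a local maximum. -/
theorem IsLocalMax.second_deriv_nonpos {φ φ' : ℝ → ℝ} {c : ℝ} (hmax : IsLocalMax φ 0)
    (h1 : ∀ᶠ t in 𝓝 (0 : ℝ), HasDerivAt φ (φ' t) t) (h2 : HasDerivAt φ' c 0) : c ≤ 0 := by
  by_contra! hc
  have e1 : deriv φ =ᶠ[𝓝 0] φ' := h1.mono fun t ht => ht.deriv
  have e2 : deriv (deriv φ) 0 = c := by rw [e1.deriv_eq, h2.deriv]
  -- If `c > 0`, the point is also a local minimum, so `φ` is locally constant and `c = 0`.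
  have hmin : IsLocalMin φ 0 := isLocalMin_of_deriv_deriv_pos (by rw [e2]; exact hc)
    hmax.deriv_eq_zero h1.self_of_nhds.continuousAt
  have hconst : φ =ᶠ[𝓝 0] fun _ => φ 0 := by
    filter_upwards [hmax, hmin] with t ht1 ht2 using le_antisymm ht1 ht2
  have : deriv φ =ᶠ[𝓝 0] fun _ => 0 := by
    filter_upwards [hconst.deriv] with t ht
    simpa using ht
  rw [this.deriv_eq] at e2
  simp at e2
  exact hc.ne e2

/-- Difference quotients at moving base points converge to the strict derivative. -/
theorem HasStrictFDerivAt.tendsto_diffQuot {f : EuclideanSpace ℝ (Fin N) → ℝ}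
    {f' : EuclideanSpace ℝ (Fin N) →L[ℝ] ℝ} {a : EuclideanSpace ℝ (Fin N)}
    (hf : HasStrictFDerivAt f f' a) {x : ℕ → EuclideanSpace ℝ (Fin N)} {h : ℕ → ℝ}
    (hx : Tendsto x atTop (𝓝 a)) (hh : Tendsto h atTop (𝓝 0)) (h0 : ∀ n, h n ≠ 0) (i : Fin N) :
    Tendsto (fun n => diffQuot (h n) i f (x n)) atTop (𝓝 (f' (stdVec i))) := by
  have hx' : Tendsto (fun n => x n + h n • stdVec i) atTop (𝓝 a) := by
    simpa using hx.add (hh.smul_const (stdVec i))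
  have ho := hf.isLittleO.comp_tendsto (hx'.prodMk_nhds hx)
  have ho' : (fun n => f (x n + h n • stdVec i) - f (x n) - h n * f' (stdVec i))
      =o[atTop] h := by
    have : (fun n => f (x n + h n • stdVec i) - f (x n) - h n * f' (stdVec i))
      =o[atTop] fun n => h n • stdVec i := by
      simpa [Function.comp_def] using ho
    refine this.trans_isBigO (Asymptotics.isBigO_of_le _ fun n => ?_)
    simp [norm_smul]
  have ht := ho'.tendsto_div_nhds_zero.add_const (f' (stdVec i))
  rw [zero_add] at ht
  refine ht.congr fun n => ?_
  have := h0 n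
  unfold diffQuot
  field_simp
  ring

theorem DifferentiableAt.hasDerivAt_line {u : EuclideanSpace ℝ (Fin N) → ℝ}
    {x : EuclideanSpace ℝ (Fin N)} {t : ℝ} {i : Fin N}
    (hu : DifferentiableAt ℝ u (x + t • stdVec i)) :
    HasDerivAt (fun t : ℝ => u (x + t • stdVec i)) (partialDeriv i u (x + t • stdVec i)) t := by
  have h1 : HasDerivAt (fun t : ℝ => x + t • stdVec i) (stdVec i) t := by
    simpa using ((hasDerivAt_id t).smul_const (stdVec i)).const_add x
  exact hu.hasFDerivAt.comp_hasDerivAt t h1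

/-- Differencing commutes with `∂ⱼ`, so two derivatives of a squared difference quotient cost only
two derivatives of `u`. -/
theorem DifferentiableAt.hasDerivAt_diffQuot_line {u : EuclideanSpace ℝ (Fin N) → ℝ}
    {x : EuclideanSpace ℝ (Fin N)} {t h : ℝ} {i j : Fin N}
    (hu : DifferentiableAt ℝ u (x + t • stdVec j))
    (hu' : DifferentiableAt ℝ u (x + t • stdVec j + h • stdVec i)) :
    HasDerivAt (fun t : ℝ => diffQuot h i u (x + t • stdVec j))
      (diffQuot h i (partialDeriv j u) (x + t • stdVec j)) t := by
  have e : ∀ s : ℝ, x + s • stdVec j + h • stdVec i = (x + h • stdVec i) + s • stdVec j :=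
    fun s => by abel
  simp only [diffQuot, e] at hu' ⊢
  exact (hu'.hasDerivAt_line.sub hu.hasDerivAt_line).const_mul _

theorem ContDiffOn.partialDeriv {u : EuclideanSpace ℝ (Fin N) → ℝ}
    {Ω : Set (EuclideanSpace ℝ (Fin N))} (hu : ContDiffOn ℝ 2 u Ω) (hΩ : IsOpen Ω) (i : Fin N) :
    ContDiffOn ℝ 1 (partialDeriv i u) Ω :=
  (hu.fderiv_of_isOpen hΩ (by norm_num)).clm_apply contDiffOn_const

theorem laplacian_eq_sum_partialDeriv {u : EuclideanSpace ℝ (Fin N) → ℝ}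
    {Ω : Set (EuclideanSpace ℝ (Fin N))} (hu : ContDiffOn ℝ 2 u Ω) (hΩ : IsOpen Ω)
    {x : EuclideanSpace ℝ (Fin N)} (hx : x ∈ Ω) :
    Laplacian.laplacian u x = ∑ i, partialDeriv i (partialDeriv i u) x := by
  rw [InnerProductSpace.laplacian_eq_iteratedFDeriv_orthonormalBasis u
    (EuclideanSpace.basisFun (Fin N) ℝ)]
  refine Finset.sum_congr rfl fun i _ => ?_
  have hd : DifferentiableAt ℝ (fderiv ℝ u) x :=
    ((hu.fderiv_of_isOpen hΩ (m := 1) (by norm_num)).differentiableOn (by norm_num)).differentiableAt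
      (hΩ.mem_nhds hx)
  rw [iteratedFDeriv_two_apply]
  unfold partialDeriv
  rw [fderiv_clm_apply hd (differentiableAt_const _)]
  simp

theorem gradient_apply_eq_partialDeriv (u : EuclideanSpace ℝ (Fin N) → ℝ)
    (x : EuclideanSpace ℝ (Fin N)) (i : Fin N) : gradient u x i = partialDeriv i u x := by
  have : inner ℝ (gradient u x) (stdVec i) = fderiv ℝ u x (stdVec i) := by
    rw [← toDual_gradient]; rfl
  rw [partialDeriv, ← this, EuclideanSpace.inner_single_right]
  simp

theorem norm_gradient_sq_eq_sum (u : EuclideanSpace ℝ (Fin N) → ℝ)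
    (x : EuclideanSpace ℝ (Fin N)) : ‖gradient u x‖ ^ 2 = ∑ i, partialDeriv i u x ^ 2 := by
  simp only [EuclideanSpace.real_norm_sq_eq, gradient_apply_eq_partialDeriv]

/-- Linear functionals evaluated at the gradient. -/
theorem apply_gradient_eq_sum (L : EuclideanSpace ℝ (Fin N) →L[ℝ] ℝ)
    (u : EuclideanSpace ℝ (Fin N) → ℝ) (x : EuclideanSpace ℝ (Fin N)) :
    L (gradient u x) = ∑ i, partialDeriv i u x * L (stdVec i) := by
  conv_lhs => rw [← (EuclideanSpace.basisFun (Fin N) ℝ).sum_repr (gradient u x)]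
  simp [map_sum, gradient_apply_eq_partialDeriv]

/-! ### The barrier `ballGap x₀ R ^ (-k)`. -/

/-- The function `R² - |x - x₀|²`, positive in the ball of radius `R` about `x₀`. -/
def ballGap (x₀ : EuclideanSpace ℝ (Fin N)) (R : ℝ) (x : EuclideanSpace ℝ (Fin N)) : ℝ :=
  R ^ 2 - ‖x - x₀‖ ^ 2

theorem ballGap_pos {x₀ x : EuclideanSpace ℝ (Fin N)} {R : ℝ} (hx : x ∈ ball x₀ R) :
    0 < ballGap x₀ R x := by
  rw [mem_ball, dist_eq_norm] at hx
  have := norm_nonneg (x - x₀)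
  unfold ballGap
  nlinarith

theorem ballGap_nonneg {x₀ x : EuclideanSpace ℝ (Fin N)} {R : ℝ} (hx : x ∈ closedBall x₀ R) :
    0 ≤ ballGap x₀ R x := by
  rw [mem_closedBall, dist_eq_norm] at hx
  have := norm_nonneg (x - x₀)
  unfold ballGap
  nlinarith

theorem continuous_ballGap (x₀ : EuclideanSpace ℝ (Fin N)) (R : ℝ) :
    Continuous (ballGap x₀ R) := by
  unfold ballGap; fun_prop

theorem hasFDerivAt_ballGap (x₀ : EuclideanSpace ℝ (Fin N)) (R : ℝ)
    (x : EuclideanSpace ℝ (Fin N)) :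
    HasFDerivAt (ballGap x₀ R) (-(2 • innerSL ℝ (x - x₀))) x := by
  have := (((hasFDerivAt_id x).sub_const x₀).norm_sq).const_sub (R ^ 2)
  refine this.congr_fderiv ?_
  ext v
  simp

theorem hasDerivAt_ballGap_line (x₀ : EuclideanSpace ℝ (Fin N)) (R : ℝ)
    (x : EuclideanSpace ℝ (Fin N)) (i : Fin N) (t : ℝ) :
    HasDerivAt (fun t : ℝ => ballGap x₀ R (x + t • stdVec i)) (-2 * ((x - x₀) i + t)) t := by
  have h := (hasFDerivAt_ballGap x₀ R (x + t • stdVec i)).differentiableAt.hasDerivAt_line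
  convert h using 1
  rw [partialDeriv, (hasFDerivAt_ballGap x₀ R _).fderiv]
  simp [EuclideanSpace.inner_single_right]
  ring

theorem hasDerivAt_ballGap_rpow_line {x₀ : EuclideanSpace ℝ (Fin N)} {R : ℝ}
    {x : EuclideanSpace ℝ (Fin N)} {i : Fin N} {t : ℝ}
    (hx : x + t • stdVec i ∈ ball x₀ R) (k : ℝ) :
    HasDerivAt (fun t : ℝ => ballGap x₀ R (x + t • stdVec i) ^ (-k))
      (2 * k * (((x - x₀) i + t) * ballGap x₀ R (x + t • stdVec i) ^ (-k - 1))) t := by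
  convert (hasDerivAt_ballGap_line x₀ R x i t).rpow_const (p := -k)
    (Or.inl (ballGap_pos hx).ne') using 1
  ring

theorem hasDerivAt_deriv_ballGap_rpow_line {x₀ : EuclideanSpace ℝ (Fin N)} {R : ℝ}
    {x : EuclideanSpace ℝ (Fin N)} (hx : x ∈ ball x₀ R) (i : Fin N) (k : ℝ) :
    HasDerivAt
      (fun t : ℝ => 2 * k * (((x - x₀) i + t) * ballGap x₀ R (x + t • stdVec i) ^ (-k - 1)))
      (2 * k * (ballGap x₀ R x ^ (-k - 1)
        + 2 * (k + 1) * (x - x₀) i ^ 2 * ballGap x₀ R x ^ (-k - 2))) 0 := by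
  have hx' : x + (0 : ℝ) • stdVec i ∈ ball x₀ R := by simpa using hx
  have h := (((hasDerivAt_id (0 : ℝ)).const_add ((x - x₀) i)).mul
    (hasDerivAt_ballGap_rpow_line hx' (k + 1))).const_mul (2 * k)
  have e1 : -(k + 1) = -k - 1 := by ring
  have e2 : -(k + 1) - 1 = -k - 2 := by ring
  rw [e2, e1] at h
  refine h.congr_deriv ?_
  simp only [zero_smul, add_zero, id]
  ring

/-! ### The Bernstein inequality for `C²` functions. -/

/-- Second-order condition at a point where the squared discrete gradient touches a multiple of
`ballGap x₀ R ^ (-k)` from below. -/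
theorem diffQuot_laplacian_le_of_touching {u : EuclideanSpace ℝ (Fin N) → ℝ}
    {Ω : Set (EuclideanSpace ℝ (Fin N))} (hu : ContDiffOn ℝ 2 u Ω) (hΩ : IsOpen Ω)
    {x₀ x : EuclideanSpace ℝ (Fin N)} {R h k m : ℝ} (hsub : ball x₀ (2 * R) ⊆ Ω)
    (h0 : 0 < h) (hR : h < R) (hx : x ∈ ball x₀ R)
    (hle : ∀ y ∈ ball x₀ R, ∑ i, diffQuot h i u y ^ 2 ≤ m * ballGap x₀ R y ^ (-k))
    (heq : ∑ i, diffQuot h i u x ^ 2 = m * ballGap x₀ R x ^ (-k)) :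
    2 * ∑ i, (diffQuot h i (partialDeriv i u) x ^ 2
        + diffQuot h i u x * diffQuot h i (Laplacian.laplacian u) x)
      ≤ m * ∑ j, (2 * k * (ballGap x₀ R x ^ (-k - 1)
        + 2 * (k + 1) * (x - x₀) j ^ 2 * ballGap x₀ R x ^ (-k - 2))) := by
  have hmem : ∀ y ∈ ball x₀ R, y ∈ Ω := fun y hy =>
    hsub (ball_subset_ball (by linarith) hy)
  have hmem' : ∀ y ∈ ball x₀ R, ∀ i, y + h • stdVec i ∈ Ω := by
    intro y hy i
    apply hsub
    rw [mem_ball, dist_eq_norm] at hy ⊢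
    have e : y + h • stdVec i - x₀ = (y - x₀) + h • stdVec i := by abel
    calc ‖y + h • stdVec i - x₀‖ ≤ ‖y - x₀‖ + ‖h • stdVec i‖ := by rw [e]; exact norm_add_le _ _
      _ = ‖y - x₀‖ + h := by simp [norm_smul, abs_of_pos h0]
      _ < 2 * R := by linarith
  have hd : ∀ y ∈ Ω, DifferentiableAt ℝ u y := fun y hy =>
    (hu.differentiableOn (by norm_num)).differentiableAt (hΩ.mem_nhds hy)
  have hd' : ∀ j, ∀ y ∈ Ω, DifferentiableAt ℝ (partialDeriv j u) y := fun j y hy =>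
    ((hu.partialDeriv hΩ j).differentiableOn (by norm_num)).differentiableAt (hΩ.mem_nhds hy)
  -- One-dimensional second-order condition along each axis `j`; summing over `j` produces the
  -- Laplacian.
  have key : ∀ j, 2 * ∑ i, (diffQuot h i (partialDeriv j u) x ^ 2
        + diffQuot h i u x * diffQuot h i (partialDeriv j (partialDeriv j u)) x)
      ≤ m * (2 * k * (ballGap x₀ R x ^ (-k - 1)
        + 2 * (k + 1) * (x - x₀) j ^ 2 * ballGap x₀ R x ^ (-k - 2))) := by
    intro j
    have hcont : Tendsto (fun t : ℝ => x + t • stdVec j) (𝓝 0) (𝓝 x) := by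
      have : Continuous (fun t : ℝ => x + t • stdVec j) := by fun_prop
      simpa using this.tendsto 0
    have hball : ∀ᶠ t in 𝓝 (0 : ℝ), x + t • stdVec j ∈ ball x₀ R :=
      hcont.eventually (isOpen_ball.mem_nhds hx)
    have hmax : IsLocalMax (fun t : ℝ => ∑ i, diffQuot h i u (x + t • stdVec j) ^ 2
        - m * ballGap x₀ R (x + t • stdVec j) ^ (-k)) 0 := by
      filter_upwards [hball] with t ht
      have := hle _ ht
      simp only [zero_smul, add_zero]
      linarith
    have hder := hmax.second_deriv_nonpos
      (φ' := fun t => ∑ i, 2 * (diffQuot h i u (x + t • stdVec j)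
          * diffQuot h i (partialDeriv j u) (x + t • stdVec j))
        - m * (2 * k * (((x - x₀) j + t) * ballGap x₀ R (x + t • stdVec j) ^ (-k - 1))))
      (c := ∑ i, 2 * (diffQuot h i (partialDeriv j u) x * diffQuot h i (partialDeriv j u) x
          + diffQuot h i u x * diffQuot h i (partialDeriv j (partialDeriv j u)) x)
        - m * (2 * k * (ballGap x₀ R x ^ (-k - 1)
        + 2 * (k + 1) * (x - x₀) j ^ 2 * ballGap x₀ R x ^ (-k - 2)))) ?_ ?_
    · rw [← Finset.mul_sum] at hder
      simp only [pow_two] at hder ⊢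
      linarith
    · filter_upwards [hball] with t ht
      refine HasDerivAt.sub (HasDerivAt.fun_sum fun i _ => ?_)
        ((hasDerivAt_ballGap_rpow_line ht k).const_mul m)
      have := ((hd _ (hmem _ ht)).hasDerivAt_diffQuot_line (hd _ (hmem' _ ht i))).pow 2
      refine this.congr_deriv ?_
      simp only [Nat.cast_ofNat, Nat.add_one_sub_one, pow_one]
      ring
    · have hx' : x + (0 : ℝ) • stdVec j ∈ ball x₀ R := by simpa using hx
      refine HasDerivAt.sub (HasDerivAt.fun_sum fun i _ => ?_)
        ((hasDerivAt_deriv_ballGap_rpow_line hx j k).const_mul m)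
      have h1 := (hd _ (hmem _ hx')).hasDerivAt_diffQuot_line (hd _ (hmem' _ hx' i))
      have h2 := (hd' j _ (hmem _ hx')).hasDerivAt_diffQuot_line (hd' j _ (hmem' _ hx' i))
      refine ((h1.mul h2).const_mul 2).congr_deriv ?_
      simp only [zero_smul, add_zero]
  have hlap : ∀ i, diffQuot h i (Laplacian.laplacian u) x
      = ∑ j, diffQuot h i (partialDeriv j (partialDeriv j u)) x := by
    intro i
    simp only [diffQuot]
    rw [laplacian_eq_sum_partialDeriv hu hΩ (hmem x hx),
      laplacian_eq_sum_partialDeriv hu hΩ (hmem' x hx i), ← Finset.sum_sub_distrib,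
      Finset.mul_sum]
  calc 2 * ∑ i, (diffQuot h i (partialDeriv i u) x ^ 2
        + diffQuot h i u x * diffQuot h i (Laplacian.laplacian u) x)
      ≤ 2 * ∑ i, (∑ j, diffQuot h i (partialDeriv j u) x ^ 2
        + diffQuot h i u x * diffQuot h i (Laplacian.laplacian u) x) := by
        -- Only the diagonal second derivatives are kept; they suffice for the trace inequality.
        gcongr with i
        exact Finset.single_le_sum (f := fun j => diffQuot h i (partialDeriv j u) x ^ 2)
          (fun j _ => sq_nonneg _) (Finset.mem_univ i)
    _ = ∑ j, 2 * ∑ i, (diffQuot h i (partialDeriv j u) x ^ 2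
        + diffQuot h i u x * diffQuot h i (partialDeriv j (partialDeriv j u)) x) := by
        rw [← Finset.mul_sum, Finset.sum_comm]
        simp only [hlap, Finset.mul_sum, Finset.sum_add_distrib]
    _ ≤ _ := by
        rw [Finset.mul_sum]
        exact Finset.sum_le_sum fun j _ => key j

/-- Since `ballGap x₀ R x` and `|x - x₀|²` are both at most `R²`, both terms fit under one power;
relative to the barrier the cost is `R² / ballGap²`. -/
theorem sum_ballGap_second_deriv_le {x₀ x : EuclideanSpace ℝ (Fin N)} {R k : ℝ} (hk : 0 < k)
    (hx : x ∈ ball x₀ R) :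
    ∑ j, (2 * k * (ballGap x₀ R x ^ (-k - 1)
        + 2 * (k + 1) * (x - x₀) j ^ 2 * ballGap x₀ R x ^ (-k - 2)))
      ≤ (2 * k * N + 4 * k * (k + 1)) * R ^ 2 * ballGap x₀ R x ^ (-k - 2) := by
  have hs := ballGap_pos hx
  have hsR : ballGap x₀ R x ≤ R ^ 2 := by unfold ballGap; nlinarith [sq_nonneg ‖x - x₀‖]
  have hnR : ‖x - x₀‖ ^ 2 ≤ R ^ 2 := by unfold ballGap at hs; linarith
  have e : ballGap x₀ R x ^ (-k - 1) = ballGap x₀ R x * ballGap x₀ R x ^ (-k - 2) := by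
    rw [← Real.rpow_one_add' hs.le (by linarith)]
    congr 1; ring
  have e2 : ∑ j, (2 * k * (ballGap x₀ R x ^ (-k - 1)
        + 2 * (k + 1) * (x - x₀) j ^ 2 * ballGap x₀ R x ^ (-k - 2)))
      = 2 * k * (N * ballGap x₀ R x + 2 * (k + 1) * ‖x - x₀‖ ^ 2)
        * ballGap x₀ R x ^ (-k - 2) := by
    rw [← Finset.mul_sum, Finset.sum_add_distrib, ← Finset.sum_mul, ← Finset.mul_sum,
      ← EuclideanSpace.real_norm_sq_eq, e]
    simp
    ring
  rw [e2]
  have hpos : 0 ≤ ballGap x₀ R x ^ (-k - 2) := Real.rpow_nonneg hs.le _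
  refine mul_le_mul_of_nonneg_right ?_ hpos
  have hN : (0 : ℝ) ≤ N := Nat.cast_nonneg N
  have h1 : (N : ℝ) * ballGap x₀ R x ≤ N * R ^ 2 := mul_le_mul_of_nonneg_left hsR hN
  have h2 : 2 * (k + 1) * ‖x - x₀‖ ^ 2 ≤ 2 * (k + 1) * R ^ 2 :=
    mul_le_mul_of_nonneg_left hnR (by linarith)
  have h3 := mul_le_mul_of_nonneg_left (add_le_add h1 h2) (by linarith : 0 ≤ 2 * k)
  linarith

/-- **Bernstein's method without third derivatives.** For `u` of class `C²`, the weighted squared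
gradient `|∇u|² (R² - |x - x₀|²) ^ k` attains its maximum over a ball at a point where the
Bochner inequality holds against the maximality condition. -/
theorem exists_bernstein_point {u : EuclideanSpace ℝ (Fin N) → ℝ}
    {Ω : Set (EuclideanSpace ℝ (Fin N))} (hu : ContDiffOn ℝ 2 u Ω) (hΩ : IsOpen Ω)
    {x₀ : EuclideanSpace ℝ (Fin N)} {R k : ℝ} (hsub : ball x₀ (2 * R) ⊆ Ω)
    (hR : 0 < R) (hk : 0 < k) (hgrad : gradient u x₀ ≠ 0) :
    ∃ a ∈ ball x₀ R, ∃ m > 0,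
      (∀ y ∈ ball x₀ R, ‖gradient u y‖ ^ 2 ≤ m * ballGap x₀ R y ^ (-k)) ∧
      ‖gradient u a‖ ^ 2 = m * ballGap x₀ R a ^ (-k) ∧
      ∀ L : EuclideanSpace ℝ (Fin N) →L[ℝ] ℝ,
        HasStrictFDerivAt (Laplacian.laplacian u) L a →
        2 * Laplacian.laplacian u a ^ 2 + 2 * N * L (gradient u a)
          ≤ N * ((2 * k * N + 4 * k * (k + 1)) * R ^ 2 * ‖gradient u a‖ ^ 2
            / ballGap x₀ R a ^ 2) := by
  set G : ℝ → EuclideanSpace ℝ (Fin N) → ℝ := fun h x =>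
    (∑ i, diffQuot h i u x ^ 2) * ballGap x₀ R x ^ k with hG
  -- The shift by 2 gives `h n < R` already at `n = 0`, so shifted points stay in the ball of radius
  -- `2R`.
  set h : ℕ → ℝ := fun n => R / (n + 2) with hh
  have h_pos : ∀ n, 0 < h n := fun n => by positivity
  have h_lt : ∀ n, h n < R := fun n => by
    rw [hh]; simp only
    rw [div_lt_iff₀ (by positivity)]
    have : (0 : ℝ) ≤ n := Nat.cast_nonneg n
    nlinarith
  have h_lim : Tendsto h atTop (𝓝 0) :=
    tendsto_const_nhds.div_atTop
      (tendsto_atTop_add_const_right _ _ tendsto_natCast_atTop_atTop)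
  have hcb : closedBall x₀ R ⊆ Ω := fun y hy =>
    hsub (closedBall_subset_ball (by linarith) hy)
  have hshift : ∀ n i, ∀ y ∈ closedBall x₀ R, y + h n • stdVec i ∈ Ω := by
    intro n i y hy
    apply hsub
    rw [mem_closedBall, dist_eq_norm] at hy
    rw [mem_ball, dist_eq_norm]
    have e : y + h n • stdVec i - x₀ = (y - x₀) + h n • stdVec i := by abel
    calc ‖y + h n • stdVec i - x₀‖ ≤ ‖y - x₀‖ + ‖h n • stdVec i‖ := by
          rw [e]; exact norm_add_le _ _
      _ = ‖y - x₀‖ + h n := by simp [norm_smul, abs_of_pos (h_pos n)]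
      _ < 2 * R := by linarith [h_lt n]
  have hGcont : ∀ n, ContinuousOn (G (h n)) (closedBall x₀ R) := by
    intro n
    refine ContinuousOn.mul (continuousOn_finsetSum _ fun i _ => ContinuousOn.pow ?_ 2) ?_
    · refine continuousOn_const.mul (ContinuousOn.sub ?_ (hu.continuousOn.mono hcb))
      exact hu.continuousOn.comp (by fun_prop) (fun y hy => hshift n i y hy)
    · exact ((continuous_ballGap x₀ R).rpow_const fun _ => Or.inr hk.le).continuousOn
  have hx₀R : x₀ ∈ ball x₀ R := mem_ball_self hR
  choose x hxmem hxmax using fun n =>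
    (isCompact_closedBall x₀ R).exists_isMaxOn ⟨x₀, ball_subset_closedBall hx₀R⟩ (hGcont n)
  obtain ⟨a, ha, φ, hφ, hxa⟩ := (isCompact_closedBall x₀ R).tendsto_subseq hxmem
  have hhφ : Tendsto (h ∘ φ) atTop (𝓝 0) := h_lim.comp hφ.tendsto_atTop
  have hstrict : ∀ y ∈ Ω, HasStrictFDerivAt u (fderiv ℝ u y) y := fun y hy =>
    (hu.contDiffAt (hΩ.mem_nhds hy)).hasStrictFDerivAt (by norm_num)
  have hstrict' : ∀ i, ∀ y ∈ Ω,
      HasStrictFDerivAt (partialDeriv i u) (fderiv ℝ (partialDeriv i u) y) y := fun i y hy =>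
    ((hu.partialDeriv hΩ i).contDiffAt (hΩ.mem_nhds hy)).hasStrictFDerivAt (by norm_num)
  have hφ0 : ∀ n, (h ∘ φ) n ≠ 0 := fun n => (h_pos _).ne'
  -- convergence of the discrete quantities along converging base points
  have hGlim : ∀ (b : EuclideanSpace ℝ (Fin N)) (y : ℕ → EuclideanSpace ℝ (Fin N)), b ∈ Ω →
      Tendsto y atTop (𝓝 b) → Tendsto (fun n => G ((h ∘ φ) n) (y n)) atTop
        (𝓝 (‖gradient u b‖ ^ 2 * ballGap x₀ R b ^ k)) := by
    intro b y hb hy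
    rw [norm_gradient_sq_eq_sum]
    refine Tendsto.mul (tendsto_finsetSum _ fun i _ => Tendsto.pow ?_ 2) ?_
    · exact (hstrict b hb).tendsto_diffQuot hy hhφ hφ0 i
    · exact (((continuous_ballGap x₀ R).rpow_const fun _ => Or.inr hk.le).tendsto b).comp hy
  set m := ‖gradient u a‖ ^ 2 * ballGap x₀ R a ^ k with hm
  have hmlim : Tendsto (fun n => G ((h ∘ φ) n) ((x ∘ φ) n)) atTop (𝓝 m) :=
    hGlim a _ (hcb ha) hxa
  have hmax : ∀ y ∈ closedBall x₀ R, ‖gradient u y‖ ^ 2 * ballGap x₀ R y ^ k ≤ m := by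
    intro y hy
    exact le_of_tendsto_of_tendsto' (hGlim y _ (hcb hy) tendsto_const_nhds) hmlim
      fun n => hxmax (φ n) hy
  have hmpos : 0 < m := by
    refine lt_of_lt_of_le ?_ (hmax x₀ (ball_subset_closedBall hx₀R))
    have := ballGap_pos hx₀R
    have := norm_pos_iff.mpr hgrad
    positivity
  -- The weight vanishes on the sphere while the maximum `m` is positive.
  have haR : a ∈ ball x₀ R := by
    rcases (mem_closedBall.mp ha).lt_or_eq with hlt | heq
    · exact hlt
    · exfalso
      have : ballGap x₀ R a = 0 := by
        rw [dist_eq_norm] at heq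
        unfold ballGap; rw [heq]; ring
      rw [hm, this, Real.zero_rpow hk.ne'] at hmpos
      simp at hmpos
  have hcancel : ∀ y ∈ ball x₀ R, ballGap x₀ R y ^ k * ballGap x₀ R y ^ (-k) = 1 := by
    intro y hy
    rw [← Real.rpow_add (ballGap_pos hy)]
    simp
  have hdiv : ∀ y ∈ ball x₀ R, ∀ A B : ℝ, A * ballGap x₀ R y ^ k ≤ B →
      A ≤ B * ballGap x₀ R y ^ (-k) := by
    intro y hy A B hAB
    have := mul_le_mul_of_nonneg_right hAB (Real.rpow_nonneg (ballGap_pos hy).le (-k))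
    rwa [mul_assoc, hcancel y hy, mul_one] at this
  have heqa : ‖gradient u a‖ ^ 2 = m * ballGap x₀ R a ^ (-k) := by
    rw [hm, mul_assoc, hcancel a haR, mul_one]
  refine ⟨a, haR, m, hmpos, fun y hy => hdiv y hy _ _ (hmax y (ball_subset_closedBall hy)),
    heqa, fun L hL => ?_⟩
  have hev : ∀ᶠ n in atTop, (x ∘ φ) n ∈ ball x₀ R := hxa.eventually (isOpen_ball.mem_nhds haR)
  have hineq : ∀ᶠ n in atTop,
      2 * ∑ i, (diffQuot ((h ∘ φ) n) i (partialDeriv i u) ((x ∘ φ) n) ^ 2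
        + diffQuot ((h ∘ φ) n) i u ((x ∘ φ) n)
          * diffQuot ((h ∘ φ) n) i (Laplacian.laplacian u) ((x ∘ φ) n))
      ≤ G ((h ∘ φ) n) ((x ∘ φ) n) * ((2 * k * N + 4 * k * (k + 1)) * R ^ 2
          * ballGap x₀ R ((x ∘ φ) n) ^ (-k - 2)) := by
    filter_upwards [hev] with n hn
    refine (diffQuot_laplacian_le_of_touching hu hΩ hsub (h_pos _) (h_lt _) hn
      (m := G ((h ∘ φ) n) ((x ∘ φ) n)) (k := k) (fun y hy => ?_) ?_).trans ?_
    · exact hdiv y hy _ _ (hxmax (φ n) (ball_subset_closedBall hy))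
    · simp only [hG]
      rw [mul_assoc, hcancel _ hn, mul_one]; rfl
    · refine mul_le_mul_of_nonneg_left (sum_ballGap_second_deriv_le hk hn) ?_
      exact mul_nonneg (Finset.sum_nonneg fun i _ => sq_nonneg _)
        (Real.rpow_nonneg (ballGap_pos hn).le _)
  have hsa := ballGap_pos haR
  -- The base points move with the step, hence the need for strict differentiability of `Δu` at `a`.
  have hlimit := le_of_tendsto_of_tendsto
    (b := atTop)
    (Tendsto.const_mul 2 (tendsto_finsetSum Finset.univ fun i _ =>
      (((hstrict' i a (hcb ha)).tendsto_diffQuot hxa hhφ hφ0 i).pow 2).add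
        (((hstrict a (hcb ha)).tendsto_diffQuot hxa hhφ hφ0 i).mul
          (hL.tendsto_diffQuot hxa hhφ hφ0 i))))
    (hmlim.mul (Tendsto.const_mul ((2 * k * N + 4 * k * (k + 1)) * R ^ 2)
      ((((continuous_ballGap x₀ R).tendsto a).comp hxa).rpow_const
        (p := -k - 2) (Or.inl hsa.ne')))) hineq
  have hcs : Laplacian.laplacian u a ^ 2
      ≤ N * ∑ i, (fderiv ℝ (partialDeriv i u) a) (stdVec i) ^ 2 := by
    rw [laplacian_eq_sum_partialDeriv hu hΩ (hcb ha)]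
    simpa [partialDeriv] using sq_sum_le_card_mul_sum_sq (s := (Finset.univ : Finset (Fin N)))
      (f := fun i => partialDeriv i (partialDeriv i u) a)
  have hrhs : m * ((2 * k * N + 4 * k * (k + 1)) * R ^ 2 * ballGap x₀ R a ^ (-k - 2))
      = (2 * k * N + 4 * k * (k + 1)) * R ^ 2 * ‖gradient u a‖ ^ 2 / ballGap x₀ R a ^ 2 := by
    rw [heqa, Real.rpow_sub hsa, Real.rpow_two]
    ring
  rw [hrhs, Finset.sum_add_distrib] at hlimit
  have hLg : L (gradient u a) = ∑ i, fderiv ℝ u a (stdVec i) * L (stdVec i) :=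
    apply_gradient_eq_sum L u a
  rw [hLg]
  have hN : (0 : ℝ) ≤ N := Nat.cast_nonneg N
  have := mul_le_mul_of_nonneg_left hlimit hN
  linarith

/-! ### The threshold and Young's inequality. -/

theorem MDagger_pos (hN : 1 ≤ N) {p : ℝ} (hp : 1 < p) : 0 < MDagger N p := by
  have hN' : (0 : ℝ) < N := by exact_mod_cast hN
  have h1 : 0 < p - 1 := by linarith
  have h2 : 0 < p := by linarith
  unfold MDagger
  positivity

/-- `MDagger` is the sharp constant in a weighted Young inequality. -/
theorem sqrt_mul_le_add_MDagger_mul (hN : 1 ≤ N) {p q : ℝ} (hp : 1 < p)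
    (hq : q = 2 * p / (p + 1)) {a Y : ℝ} (ha : 0 ≤ a) (hY : 0 ≤ Y) :
    √(N * p) * (a ^ ((p - 1) / 2) * Y) ≤ a ^ p + MDagger N p * Y ^ q := by
  have hN' : (0 : ℝ) < N := by exact_mod_cast hN
  have hp0 : 0 < p := by linarith
  have hp1 : 0 < p + 1 := by linarith
  have hp2 : 0 < p - 1 := by linarith
  have hMd := MDagger_pos hN hp
  -- Weights forced by homogeneity: `p θ = (p - 1) / 2`, `q τ = 1`, and `θ + τ = 1`.
  set θ := (p - 1) / (2 * p) with hθ
  set τ := (p + 1) / (2 * p) with hτ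
  have hθ0 : 0 < θ := by positivity
  have hτ0 : 0 < τ := by positivity
  have hsum : θ + τ = 1 := by rw [hθ, hτ]; field_simp; ring
  have hX : 0 ≤ a ^ p := Real.rpow_nonneg ha p
  have hW : 0 ≤ Y ^ q := Real.rpow_nonneg hY q
  have hyoung := Real.geom_mean_le_arith_mean2_weighted hθ0.le hτ0.le
    (div_nonneg hX hθ0.le) (div_nonneg (mul_nonneg hMd.le hW) hτ0.le) hsum
  have e1 : θ * (a ^ p / θ) + τ * (MDagger N p * Y ^ q / τ) = a ^ p + MDagger N p * Y ^ q := by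
    field_simp
  rw [e1] at hyoung
  refine le_of_eq_of_le ?_ hyoung
  have e2 : (a ^ p) ^ θ = a ^ ((p - 1) / 2) := by
    rw [← Real.rpow_mul ha]; congr 1; rw [hθ]; field_simp
  have e3 : (Y ^ q) ^ τ = Y := by
    rw [← Real.rpow_mul hY]
    have : q * τ = 1 := by rw [hq, hτ]; field_simp
    rw [this, Real.rpow_one]
  -- This identity is where the explicit value of `MDagger` enters.
  have e4 : MDagger N p ^ τ = (θ / τ) ^ θ * (√(N * p) * τ) := by
    unfold MDagger
    rw [Real.mul_rpow (by positivity) (by positivity), ← Real.rpow_mul (by positivity),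
      ← Real.rpow_mul (by positivity)]
    have f1 : (p - 1) / (p + 1) = θ / τ := by rw [hθ, hτ]; field_simp
    have f2 : (p - 1) / (p + 1) * τ = θ := by rw [hθ, hτ]; field_simp
    have f3 : p / (p + 1) * τ = 1 / 2 := by rw [hτ]; field_simp
    have f4 : (N : ℝ) * (p + 1) ^ 2 / (4 * p) = N * p * τ ^ 2 := by
      rw [hτ]; field_simp; norm_num
    rw [f2, f3, f4, f1, ← Real.sqrt_eq_rpow, Real.sqrt_mul (by positivity),
      Real.sqrt_sq hτ0.le]
  rw [Real.div_rpow hX hθ0.le, Real.div_rpow (mul_nonneg hMd.le hW) hτ0.le,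
    Real.mul_rpow hMd.le hW, e2, e3, e4, Real.div_rpow hθ0.le hτ0.le]
  have g1 : τ ^ θ * τ ^ τ = τ := by
    rw [← Real.rpow_add hτ0, hsum, Real.rpow_one]
  have g2 : 0 < θ ^ θ := Real.rpow_pos_of_pos hθ0 _
  have g3 : 0 < τ ^ θ := Real.rpow_pos_of_pos hτ0 _
  have g4 : 0 < τ ^ τ := Real.rpow_pos_of_pos hτ0 _
  field_simp
  linear_combination a ^ ((p - 1) / 2) * Y * g1

theorem mul_rpow_mul_sq_le (hN : 1 ≤ N) {p q : ℝ} (hp : 1 < p)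
    (hq : q = 2 * p / (p + 1)) {a Y : ℝ} (ha : 0 ≤ a) (hY : 0 ≤ Y) :
    N * p * a ^ (p - 1) * Y ^ 2 ≤ (a ^ p + MDagger N p * Y ^ q) ^ 2 := by
  have h := sqrt_mul_le_add_MDagger_mul hN hp hq ha hY
  have hnn : 0 ≤ √(N * p) * (a ^ ((p - 1) / 2) * Y) := by positivity
  have h2 := pow_le_pow_left₀ hnn h 2
  refine le_of_eq_of_le ?_ h2
  have e : (a ^ ((p - 1) / 2)) ^ 2 = a ^ (p - 1) := by
    rw [← Real.rpow_natCast, ← Real.rpow_mul ha]; congr 1; push_cast; ring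
  rw [mul_pow, mul_pow, e, Real.sq_sqrt (by positivity)]
  ring

/-! ### The gradient estimate in a ball. -/

/-- Solving the quadratic inequality of the Bernstein estimate. -/
theorem mul_le_of_quadratic_le {n δ ν M B C w Δ : ℝ} (hn : 0 ≤ n) (hν : 0 < ν)
    (hM : 0 < M) (hB : 0 ≤ B) (hC : 0 ≤ C) (hw : 0 ≤ w) (hΔ : Δ = δ + ν * M)
    (h : 2 * Δ ^ 2 * w ^ 2 ≤ 2 * n * M * B * w + n * C) :
    δ * w ≤ n * B / ν + n * C + 1 := by
  by_contra! hcon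
  have h0 : 0 ≤ n * B / ν := by positivity
  have h1 : 0 ≤ n * C := by positivity
  have hW1 : 1 < δ * w := by linarith
  have hWB : n * B ≤ ν * (δ * w) := by
    have : n * B / ν ≤ δ * w := by linarith
    rw [div_le_iff₀ hν] at this
    linarith
  have h2 : n * C < (δ * w) ^ 2 := by nlinarith
  -- The cross term of `(δ + ν M)²` carries the same factor `M` as the linear term on the right, so
  -- the bound does not depend on `M`.
  have h3 : (δ * w) ^ 2 + 2 * (M * w) * (ν * (δ * w)) ≤ Δ ^ 2 * w ^ 2 := by
    rw [hΔ]; nlinarith [sq_nonneg (ν * M * w)]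
  have h4 : M * w * (n * B) ≤ M * w * (ν * (δ * w)) :=
    mul_le_mul_of_nonneg_left hWB (by positivity)
  have h5 : 0 ≤ M * w * (ν * (δ * w)) := by positivity
  nlinarith

/-- At a point where `|∇u|²` touches `m * ballGap x₀ R ^ (-k)` from below, the Laplacian of a
solution is strictly differentiable and its derivative along the gradient is bounded below. -/
theorem IsNonnegSolution.exists_strictFDeriv_laplacian_ge {p q M : ℝ} (hp : 1 < p)
    (hq : q = 2 * p / (p + 1)) (hM : 0 < M)
    {Ω : Set (EuclideanSpace ℝ (Fin N))} (hΩ : IsOpen Ω) {u : EuclideanSpace ℝ (Fin N) → ℝ}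
    (hu : IsNonnegSolution p q M Ω u) {x₀ a : EuclideanSpace ℝ (Fin N)} {R k m : ℝ}
    (hk : 0 < k) (hsub : ball x₀ R ⊆ Ω) (ha : a ∈ ball x₀ R) (hm : 0 < m)
    (hle : ∀ y ∈ ball x₀ R, ‖gradient u y‖ ^ 2 ≤ m * ballGap x₀ R y ^ (-k))
    (heq : ‖gradient u a‖ ^ 2 = m * ballGap x₀ R a ^ (-k)) :
    ∃ L : EuclideanSpace ℝ (Fin N) →L[ℝ] ℝ,
      HasStrictFDerivAt (Laplacian.laplacian u) L a ∧
      -(p * u a ^ (p - 1) * ‖gradient u a‖ ^ 2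
        + M * (q * k) * (‖gradient u a‖ ^ q * ‖gradient u a‖) * R / ballGap x₀ R a)
        ≤ L (gradient u a) := by
  have haΩ := hsub ha
  have hs := ballGap_pos ha
  set s := ballGap x₀ R a with hsdef
  set Y := ‖gradient u a‖ with hY
  have hq0 : 0 < q := by rw [hq]; positivity
  have hY2 : 0 < Y ^ 2 := by rw [heq]; positivity
  have hYpos : 0 < Y := by
    rcases (norm_nonneg (gradient u a)).lt_or_eq with h | h
    · exact h
    · rw [hY, ← h] at hY2; simp at hY2
  -- As a sum of squares of `C¹` functions, `z` is `C¹`; its power `q / 2` is strictly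
  -- differentiable wherever `z ≠ 0`.
  set z : EuclideanSpace ℝ (Fin N) → ℝ := fun x => ∑ i, partialDeriv i u x ^ 2 with hz
  have hzg : ∀ x, z x = ‖gradient u x‖ ^ 2 := fun x => (norm_gradient_sq_eq_sum u x).symm
  have hzC : ContDiffOn ℝ 1 z Ω :=
    ContDiffOn.sum fun i _ => (hu.contDiffOn.partialDeriv hΩ i).pow 2
  have hzs : HasStrictFDerivAt z (fderiv ℝ z a) a :=
    (hzC.contDiffAt (hΩ.mem_nhds haΩ)).hasStrictFDerivAt (by norm_num)
  have hus : HasStrictFDerivAt u (fderiv ℝ u a) a :=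
    (hu.contDiffOn.contDiffAt (hΩ.mem_nhds haΩ)).hasStrictFDerivAt (by norm_num)
  have hza : z a ≠ 0 := by rw [hzg]; exact hY2.ne'
  have hup := (Real.hasStrictDerivAt_rpow_const (x := u a) (p := p)
    (Or.inr hp.le)).comp_hasStrictFDerivAt a hus
  have hzq := (Real.hasStrictDerivAt_rpow_const (x := z a) (p := q / 2)
    (Or.inl hza)).comp_hasStrictFDerivAt a hzs
  have hL := (hup.add (hzq.const_mul M)).neg
  have hcongr : (fun x => -(u x ^ p + M * z x ^ (q / 2)))
      =ᶠ[𝓝 a] Laplacian.laplacian u := by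
    filter_upwards [hΩ.mem_nhds haΩ] with x hx
    have e1 := hu.equation x hx
    have e2 : |u x| ^ (p - 1) * u x = u x ^ p := by
      rw [abs_of_nonneg (hu.nonneg x hx), ← Real.rpow_add_one' (hu.nonneg x hx) (by linarith)]
      congr 1; ring
    have e3 : z x ^ (q / 2) = ‖gradient u x‖ ^ q := by
      rw [hzg, ← Real.rpow_natCast, ← Real.rpow_mul (norm_nonneg _)]
      congr 1; push_cast; ring
    rw [e3, ← e2, ← e1, neg_neg]
  refine ⟨_, hL.congr_of_eventuallyEq hcongr, ?_⟩
  -- first-order condition at the contact point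
  have hψ := (hasFDerivAt_ballGap x₀ R a).rpow_const (p := -k) (Or.inl hs.ne')
  have hmax : IsLocalMax (fun y => z y - m * ballGap x₀ R y ^ (-k)) a := by
    filter_upwards [isOpen_ball.mem_nhds ha] with y hy
    have h1 := hle y hy
    rw [hzg, hzg, heq]
    linarith
  have hz' : fderiv ℝ z a (gradient u a)
      = m * (2 * k * s ^ (-k - 1) * inner ℝ (a - x₀) (gradient u a)) := by
    have h0 := hmax.hasFDerivAt_eq_zero (hzs.hasFDerivAt.sub (hψ.const_mul m))
    have h1 := congrArg (fun T : EuclideanSpace ℝ (Fin N) →L[ℝ] ℝ => T (gradient u a)) h0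
    simp [← hsdef] at h1
    have h2 : inner ℝ (a - x₀) (gradient u a) = fderiv ℝ u a a - fderiv ℝ u a x₀ := by simp
    rw [h2]
    linarith
  have hu' : fderiv ℝ u a (gradient u a) = Y ^ 2 := by
    rw [hY, ← real_inner_self_eq_norm_sq, ← toDual_gradient]; rfl
  have hms : m * s ^ (-k - 1) = Y ^ 2 / s := by
    rw [heq, Real.rpow_sub hs, Real.rpow_one]; ring
  have hzq' : z a ^ (q / 2 - 1) * Y ^ 2 = Y ^ q := by
    rw [hzg, ← hY, ← Real.rpow_add_one' (sq_nonneg Y) (by linarith), ← Real.rpow_natCast,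
      ← Real.rpow_mul hYpos.le]
    congr 1; push_cast; ring
  have hinner : inner ℝ (a - x₀) (gradient u a) ≤ R * Y := by
    refine (real_inner_le_norm _ _).trans (mul_le_mul_of_nonneg_right ?_ (norm_nonneg _))
    rw [← dist_eq_norm]; exact (mem_ball.mp ha).le
  have hval : M * ((q / 2 * z a ^ (q / 2 - 1)) * fderiv ℝ z a (gradient u a))
      = M * (q * k) * Y ^ q / s * inner ℝ (a - x₀) (gradient u a) := by
    calc _ = M * (q * k) * z a ^ (q / 2 - 1) * (m * s ^ (-k - 1))
          * inner ℝ (a - x₀) (gradient u a) := by rw [hz']; ring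
      _ = M * (q * k) * (z a ^ (q / 2 - 1) * Y ^ 2) / s
          * inner ℝ (a - x₀) (gradient u a) := by rw [hms]; ring
      _ = _ := by rw [hzq']
  have hbound : M * (q * k) * Y ^ q / s * inner ℝ (a - x₀) (gradient u a)
      ≤ M * (q * k) * Y ^ q / s * (R * Y) :=
    mul_le_mul_of_nonneg_left hinner (by positivity)
  have e : M * (q * k) * (Y ^ q * Y) * R / s = M * (q * k) * Y ^ q / s * (R * Y) := by ring
  simp only [neg_apply, add_apply,
    smul_apply, smul_eq_mul, hu', hval]
  rw [e]
  linarith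

/-- Interior gradient estimate in a ball. -/
theorem IsNonnegSolution.norm_gradient_le (hN : 1 ≤ N) {p q M ν : ℝ} (hp : 1 < p)
    (hq : q = 2 * p / (p + 1)) (hν : 0 < ν) (hM : 0 < M) (hMν : MDagger N p < (1 - ν) * M)
    {Ω : Set (EuclideanSpace ℝ (Fin N))} (hΩ : IsOpen Ω) {u : EuclideanSpace ℝ (Fin N) → ℝ}
    (hu : IsNonnegSolution p q M Ω u) {x₀ : EuclideanSpace ℝ (Fin N)} {R k : ℝ}
    (hk : k = 2 * ((p + 1) / (p - 1))) (hR : 0 < R) (hsub : ball x₀ (2 * R) ⊆ Ω) :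
    ‖gradient u x₀‖ ≤ ((N * (q * k) / ν + N * (2 * k * N + 4 * k * (k + 1)) + 1)
      / (((1 - ν) * M - MDagger N p) * R)) ^ ((p + 1) / (p - 1)) := by
  have hp1 : 0 < p - 1 := by linarith
  have hp2 : 0 < p + 1 := by linarith
  have hp0 : 0 < p := by linarith
  have hk0 : 0 < k := by rw [hk]; positivity
  have hq0 : 0 < q := by rw [hq]; positivity
  have hN0 : (0 : ℝ) ≤ N := Nat.cast_nonneg N
  set δ := (1 - ν) * M - MDagger N p with hδ
  have hδ0 : 0 < δ := by rw [hδ]; linarith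
  set C := 2 * k * N + 4 * k * (k + 1) with hC
  have hC0 : 0 ≤ C := by positivity
  set c := N * (q * k) / ν + N * C + 1 with hc
  have hc0 : 0 < c := by positivity
  by_cases hgrad : gradient u x₀ = 0
  · rw [hgrad, norm_zero]; positivity
  have hsub' : ball x₀ R ⊆ Ω := (ball_subset_ball (by linarith)).trans hsub
  obtain ⟨a, ha, m, hm, hle, heq, hbern⟩ :=
    exists_bernstein_point hu.contDiffOn hΩ hsub hR hk0 hgrad
  obtain ⟨L, hL, hLge⟩ := hu.exists_strictFDeriv_laplacian_ge hp hq hM hΩ hk0 hsub' ha hm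
    hle heq
  have hB := hbern L hL
  have haΩ := hsub' ha
  have hua := hu.nonneg a haΩ
  have hs := ballGap_pos ha
  have hx₀ : ballGap x₀ R x₀ = R ^ 2 := by simp [ballGap]
  have hlap : Laplacian.laplacian u a ^ 2 = (u a ^ p + M * ‖gradient u a‖ ^ q) ^ 2 := by
    have e2 : |u a| ^ (p - 1) * u a = u a ^ p := by
      rw [abs_of_nonneg hua, ← Real.rpow_add_one' hua (by linarith)]
      congr 1; ring
    rw [← e2, ← hu.equation a haΩ]; ring
  rw [hlap] at hB
  have hle₀ := hle x₀ (mem_ball_self hR)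
  rw [hx₀] at hle₀
  set s := ballGap x₀ R a with hsdef
  have hY2 : 0 < ‖gradient u a‖ ^ 2 := by rw [heq]; positivity
  have hYpos : 0 < ‖gradient u a‖ := by
    rcases (norm_nonneg (gradient u a)).lt_or_eq with h | h
    · exact h
    · rw [← h] at hY2; simp at hY2
  set Y := ‖gradient u a‖ with hY
  have hyoung := mul_rpow_mul_sq_le hN hp hq hua hYpos.le
  set y := Y ^ (q - 1) with hy
  have hy0 : 0 < y := Real.rpow_pos_of_pos hYpos _
  have hYq : Y ^ q = Y * y := by
    rw [hy, ← Real.rpow_one_add' hYpos.le (by linarith)]; congr 1; ring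
  -- In terms of `w`, every term of the Bernstein inequality has the common factor `Y² R² / s²`.
  set w := y * s / R with hw
  have hw0 : 0 < w := by positivity
  have hyw : y = w * R / s := by rw [hw]; field_simp
  have hMd := MDagger_pos hN hp
  have hquad : 2 * (δ + ν * M) ^ 2 * w ^ 2 ≤ 2 * N * M * (q * k) * w + N * C := by
    have hup : 0 ≤ u a ^ p := Real.rpow_nonneg hua p
    have hΔ0 : 0 < δ + ν * M := by positivity
    have hYq0 : 0 < Y ^ q := Real.rpow_pos_of_pos hYpos q
    -- The first square absorbs `N p u^(p-1) Y²` by Young; the second is the surviving gain.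
    have hgap : (u a ^ p + MDagger N p * Y ^ q) ^ 2 + (δ + ν * M) ^ 2 * (Y ^ q) ^ 2
        ≤ (u a ^ p + M * Y ^ q) ^ 2 := by
      have e : u a ^ p + M * Y ^ q
          = (u a ^ p + MDagger N p * Y ^ q) + (δ + ν * M) * Y ^ q := by
        rw [hδ]; ring
      rw [e]
      have : 0 ≤ (u a ^ p + MDagger N p * Y ^ q) * ((δ + ν * M) * Y ^ q) := by positivity
      linarith [add_sq (u a ^ p + MDagger N p * Y ^ q) ((δ + ν * M) * Y ^ q),
        mul_pow (δ + ν * M) (Y ^ q) 2]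
    have hLN := mul_le_mul_of_nonneg_left hLge hN0
    have hmain : 2 * (δ + ν * M) ^ 2 * (Y ^ q) ^ 2
        ≤ 2 * N * (M * (q * k) * (Y ^ q * Y) * R / s) + N * (C * R ^ 2 * Y ^ 2 / s ^ 2) := by
      linarith
    have hl : 2 * (δ + ν * M) ^ 2 * (Y ^ q) ^ 2
        = (2 * (δ + ν * M) ^ 2 * w ^ 2) * (Y ^ 2 * R ^ 2 / s ^ 2) := by
      rw [hYq, hyw]; field_simp
    have hr : 2 * N * (M * (q * k) * (Y ^ q * Y) * R / s) + N * (C * R ^ 2 * Y ^ 2 / s ^ 2)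
        = (2 * N * M * (q * k) * w + N * C) * (Y ^ 2 * R ^ 2 / s ^ 2) := by
      rw [hYq, hyw]; field_simp
    rw [hl, hr] at hmain
    exact le_of_mul_le_mul_right hmain (by positivity)
  have hδw : δ * w ≤ c :=
    mul_le_of_quadratic_le hN0 hν hM (by positivity) hC0 hw0.le rfl hquad
  -- The reason for the choice of `k`: it makes the maximum `m` exactly `(y s)^k`.
  have hqk : (q - 1) * k = 2 := by rw [hq, hk]; field_simp; ring
  have hys : y * s ≤ c * R / δ := by
    rw [le_div_iff₀ hδ0]
    have : y * s = w * R := by rw [hw]; field_simp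
    rw [this]
    linarith [mul_le_mul_of_nonneg_right hδw hR.le]
  have hm_eq : m = (y * s) ^ k := by
    rw [Real.mul_rpow hy0.le hs.le, hy, ← Real.rpow_mul hYpos.le, hqk, Real.rpow_two, heq,
      mul_assoc, ← Real.rpow_add hs]
    simp
  have hm_le : m ≤ (c * R / δ) ^ k := by
    rw [hm_eq]; exact Real.rpow_le_rpow (by positivity) hys hk0.le
  have hfin : ‖gradient u x₀‖ ^ 2 ≤ ((c / (δ * R)) ^ ((p + 1) / (p - 1))) ^ 2 := by
    calc ‖gradient u x₀‖ ^ 2 ≤ m * (R ^ 2) ^ (-k) := hle₀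
      _ ≤ (c * R / δ) ^ k * (R ^ 2) ^ (-k) := by gcongr
      _ = (c / (δ * R)) ^ k := by
        rw [Real.rpow_neg (by positivity), ← div_eq_mul_inv, ← Real.div_rpow (by positivity)
          (by positivity)]
        congr 1; field_simp
      _ = _ := by
        rw [← Real.rpow_natCast _ 2, ← Real.rpow_mul (by positivity), hk]
        congr 1; push_cast; ring
  exact (sq_le_sq₀ (norm_nonneg _) (by positivity)).mp hfin

/-! ### From balls to domains, and the Liouville property. -/

/-- A ball is connected: missing the frontier, it cannot meet both `Ω` and the exterior of `Ω`. -/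
theorem ball_subset_of_le_infEDist_frontier {Ω : Set (EuclideanSpace ℝ (Fin N))}
    (hΩ : IsOpen Ω) {x : EuclideanSpace ℝ (Fin N)} (hx : x ∈ Ω) {r : ℝ}
    (hr : ENNReal.ofReal r ≤ infEDist x (frontier Ω)) : ball x r ⊆ Ω := by
  intro y hy
  by_contra hyΩ
  have hr0 : 0 < r := dist_nonneg.trans_lt (mem_ball.mp hy)
  have hfr : ∀ w ∈ ball x r, w ∉ frontier Ω := by
    intro w hw hwf
    have h1 := hr.trans (infEDist_le_edist_of_mem hwf)
    rw [edist_dist, ENNReal.ofReal_le_ofReal_iff dist_nonneg, dist_comm] at h1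
    exact absurd (mem_ball.mp hw) (not_lt.mpr h1)
  rw [hΩ.frontier_eq] at hfr
  have hcl : ∀ w ∈ ball x r, w ∉ Ω → w ∈ (closure Ω)ᶜ := fun w hw hwΩ hwc => hfr w hw ⟨hwc, hwΩ⟩
  obtain ⟨w, -, hwΩ, hwc⟩ := (convex_ball x r).isPreconnected Ω (closure Ω)ᶜ hΩ
    isClosed_closure.isOpen_compl (fun w hw => or_iff_not_imp_left.mpr (hcl w hw))
    ⟨x, mem_ball_self hr0, hx⟩ ⟨y, hy, hcl y hy hyΩ⟩
  exact hwc (subset_closure hwΩ)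

theorem infEDist_frontier_pos {Ω : Set (EuclideanSpace ℝ (Fin N))} (hΩ : IsOpen Ω)
    {x : EuclideanSpace ℝ (Fin N)} (hx : x ∈ Ω) : 0 < infEDist x (frontier Ω) := by
  rw [pos_iff_ne_zero, Ne, ← mem_closure_iff_infEDist_zero, isClosed_frontier.closure_eq,
    hΩ.frontier_eq]
  exact fun h => h.2 hx

theorem exists_gradient_estimate (hN : 1 ≤ N) {p q ν : ℝ} (hp : 1 < p)
    (hq : q = 2 * p / (p + 1)) (hν : 0 < ν) :
    ∃ c : ℝ, 0 < c ∧ ∀ M : ℝ, MDagger N p < M → MDagger N p < (1 - ν) * M →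
      ∀ Ω : Set (EuclideanSpace ℝ (Fin N)), IsOpen Ω →
      ∀ u : EuclideanSpace ℝ (Fin N) → ℝ, IsNonnegSolution p q M Ω u → ∀ x ∈ Ω,
        ENNReal.ofReal ‖gradient u x‖ ≤
          ENNReal.ofReal (c * ((1 - ν) * M - MDagger N p) ^ (-((p + 1) / (p - 1)))) *
            infEDist x (frontier Ω) ^ (-((p + 1) / (p - 1))) := by
  have hp1 : 0 < p - 1 := by linarith
  have hp0 : 0 < p := by linarith
  have hq0 : 0 < q := by rw [hq]; positivity
  set α := (p + 1) / (p - 1) with hα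
  have hα0 : 0 < α := by positivity
  set k := 2 * α with hk
  have hk0 : 0 < k := by positivity
  set K : ℝ := N * (q * k) / ν + N * (2 * k * N + 4 * k * (k + 1)) + 1 with hK
  have hK0 : 0 < K := by positivity
  -- The factor 4 comes from applying the ball estimate with `R = r / 4`.
  refine ⟨(4 * K) ^ α, by positivity, fun M hM hMν Ω hΩ u hu x hx => ?_⟩
  have hM0 : 0 < M := (MDagger_pos hN hp).trans hM
  set δ := (1 - ν) * M - MDagger N p with hδ
  have hδ0 : 0 < δ := by rw [hδ]; linarith
  have hest : ∀ r : ℝ, 0 < r → ENNReal.ofReal r ≤ infEDist x (frontier Ω) →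
      ‖gradient u x‖ ≤ (4 * K) ^ α * δ ^ (-α) * r ^ (-α) := by
    intro r hr hrd
    have h := hu.norm_gradient_le hN hp hq hν hM0 hMν hΩ (R := r / 4) hk (by positivity)
      ((ball_subset_ball (by linarith)).trans (ball_subset_of_le_infEDist_frontier hΩ hx hrd))
    refine h.trans_eq ?_
    rw [← hα, ← hK, ← hδ, Real.rpow_neg hδ0.le, Real.rpow_neg hr.le, ← Real.inv_rpow hδ0.le,
      ← Real.inv_rpow hr.le, ← Real.mul_rpow (by positivity) (by positivity),
      ← Real.mul_rpow (by positivity) (by positivity)]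
    congr 1
    field_simp
  by_cases htop : infEDist x (frontier Ω) = ⊤
  -- At infinite distance every radius is admissible, and `r → ∞` kills the gradient.
  · have hlim : Tendsto (fun r : ℝ => (4 * K) ^ α * δ ^ (-α) * r ^ (-α)) atTop (𝓝 0) := by
      simpa using (tendsto_rpow_neg_atTop hα0).const_mul ((4 * K) ^ α * δ ^ (-α))
    have h0 : ‖gradient u x‖ ≤ 0 := ge_of_tendsto hlim <| by
      filter_upwards [eventually_gt_atTop 0] with r hr
      exact hest r hr (by rw [htop]; exact le_top)
    rw [ENNReal.ofReal_of_nonpos h0]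
    exact zero_le
  · have hpos := infEDist_frontier_pos hΩ hx
    have hD0 := ENNReal.toReal_pos hpos.ne' htop
    have hD := ENNReal.ofReal_toReal htop
    rw [← hD, ENNReal.ofReal_rpow_of_pos hD0, ← ENNReal.ofReal_mul (by positivity)]
    exact ENNReal.ofReal_le_ofReal (hest _ hD0 hD.le)

/-- For a constant, the equation reduces to `|u|^(p-1) u = 0`; `q > 0` ensures that the gradient
term vanishes. -/
theorem IsNonnegSolution.eq_zero_of_gradient_eq_zero {p q M : ℝ} (hp : 1 < p) (hq : 0 < q)
    {u : EuclideanSpace ℝ (Fin N) → ℝ} (hu : IsNonnegSolution p q M Set.univ u)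
    (hgrad : ∀ x, gradient u x = 0) : u = 0 := by
  have hd : Differentiable ℝ u :=
    (contDiffOn_univ.mp hu.contDiffOn).differentiable (by norm_num)
  have hconst : u = fun _ => u 0 := by
    funext x
    refine is_const_of_fderiv_eq_zero hd (fun y => ?_) x 0
    rw [← toDual_gradient, hgrad y, map_zero]
  have hlap : Laplacian.laplacian u 0 = 0 := by
    rw [hconst, InnerProductSpace.laplacian_const]; rfl
  have he := hu.equation 0 (Set.mem_univ 0)
  rw [hlap, hgrad, norm_zero, Real.zero_rpow hq.ne', mul_zero, add_zero, neg_zero] at he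
  have h0 : u 0 = 0 := by
    rcases mul_eq_zero.mp he.symm with h | h
    · rw [Real.rpow_eq_zero (abs_nonneg _) (by linarith)] at h
      exact abs_eq_zero.mp h
    · exact h
  rw [hconst, h0]; rfl

end

theorem theoremC (N : ℕ) (hN : 1 ≤ N) (p q : ℝ) (hp : 1 < p) (hq : q = 2 * p / (p + 1)) :
    -- gradient estimate; the distance to the boundary is `∞` when the boundary is empty
    (∀ ν : ℝ, 0 < ν → ∃ c : ℝ, 0 < c ∧
      ∀ M : ℝ, MDagger N p < M → MDagger N p < (1 - ν) * M →
      ∀ Ω : Set (EuclideanSpace ℝ (Fin N)), IsOpen Ω → IsConnected Ω →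
      ∀ u : EuclideanSpace ℝ (Fin N) → ℝ, IsNonnegSolution p q M Ω u →
      ∀ x ∈ Ω,
        ENNReal.ofReal ‖gradient u x‖ ≤
          ENNReal.ofReal (c * ((1 - ν) * M - MDagger N p) ^ (-((p + 1) / (p - 1)))) *
            Metric.infEDist x (frontier Ω) ^ (-((p + 1) / (p - 1)))) ∧
    -- no nontrivial solution in the whole space
    (∀ M : ℝ, MDagger N p < M →
      ¬ ∃ u : EuclideanSpace ℝ (Fin N) → ℝ, IsNonnegSolution p q M Set.univ u ∧ u ≠ 0) := by
  refine ⟨fun ν hν => ?_, ?_⟩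
  · obtain ⟨c, hc, h⟩ := exists_gradient_estimate hN hp hq hν
    exact ⟨c, hc, fun M hM hMν Ω hΩ _ u hu x hx => h M hM hMν Ω hΩ u hu x hx⟩
  · rintro M hM ⟨u, hu, hne⟩
    have hM0 : 0 < M := (MDagger_pos hN hp).trans hM
    -- This `ν` puts `(1 - ν) M` midway between `MDagger N p` and `M`.
    have hν : 0 < (M - MDagger N p) / (2 * M) := div_pos (by linarith) (by linarith)
    have hMν : MDagger N p < (1 - (M - MDagger N p) / (2 * M)) * M := by
      have e : (1 - (M - MDagger N p) / (2 * M)) * M = (M + MDagger N p) / 2 := by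
        field_simp; ring
      rw [e]; linarith
    obtain ⟨c, -, h⟩ := exists_gradient_estimate hN hp hq hν
    have hα : 0 < (p + 1) / (p - 1) := div_pos (by linarith) (by linarith)
    refine hne (hu.eq_zero_of_gradient_eq_zero hp (by rw [hq]; positivity) fun x => ?_)
    have hx := h M hM hMν Set.univ isOpen_univ u hu x (Set.mem_univ x)
    rw [frontier_univ, infEDist_empty, ENNReal.top_rpow_of_neg (by linarith), mul_zero] at hx
    exact norm_le_zero_iff.mp (ENNReal.ofReal_eq_zero.mp (le_antisymm hx zero_le))
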